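/- Let $T$ be a complete consistent first-order theory (one-sorted or many-sorted) and let $M$ be a big model of $T$: for some strongly inaccessible cardinal $\kappa$ larger than the number of symbols of the language, $M$ is $\kappa$-saturated and strongly $\kappa$-homogeneous (every elementary map from a subset of cardinality $<\kappa$ into $M$ extends to an automorphism of $M$). (In the many-sorted case, $M$ is regarded as the disjoint union of its sorts, and saturation refers to types of elements of one sort.) A set or a cardinal is called small if it has, or is, a cardinality $<\kappa$; below, $A,B,C,\dots$ denote small subsets of $M$, and all cardinals are small. Write $AB=A\cup B$; $A\equiv_C A'$ means that some automorphism of $M$ fixes $C$ pointwise and maps the set $A$ onto the set $A'$; and $\operatorname{acl}A$ is the union of all finite subsets of $M$ definable over $A$. A ternary relation $A\perp_C B$ between small subsets of $M$ is an *independence relation* if it satisfies the following axioms. - Invariance: if $A\perp_CB$ and an automorphism of $M$ maps $A,B,C$ onto $A',B',C'$, then $A'\perp_{C'}B'$. - Monotonicity: if $A\perp_CB$, $A'\subseteq A$ and $B'\subseteq B$, then $A'\perp_CB'$. - Base monotonicity: if $D\subseteq C\subseteq B$ and $A\perp_DB$, then $A\perp_CB$. - Transitivity: if $D\subseteq C\subseteq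 B$, $B\perp_CA$ and $C\perp_DA$, then $B\perp_DA$. - Normality: $A\perp_CB$ implies $AC\perp_CB$. - Extension: if $A\perp_CB$ and $\hat B\supseteq B$, then there is $A'\equiv_{BC}A$ with $A'\perp_C\hat B$. - Finite character: if $A_0\perp_CB$ for all finite $A_0\subseteq A$, then $A\perp_CB$. - Local character: for every $A$ there is a cardinal $\kappa(A)$ such that every $B$ has a subset $C$ with $|C|<\kappa(A)$ and $A\perp_CB$. It is *strict* if moreover, for every $a\in M$ and every $B$, $\{a\}\perp_B\{a\}$ implies $a\in\operatorname{acl}B$ (anti-reflexivity). *M-dividing independence* $A\perp^{M}_CB$ means that $\operatorname{acl}(AC')\cap\operatorname{acl}(BC')=\operatorname{acl}C'$ for every $C'$ with $C\subseteq C'\subseteq\operatorname{acl}(BC)$. *Thorn-forking independence* $A\perp^{\text{þ}}_CB$ means that for every $\hat B\supseteq B$ there is $A'\equiv_{BC}A$ with $A'\perp^{M}_C\hat B$. **Theorem.** The following are equivalent: (1) $\perp^{\text{þ}}$ is a strict independence relation; (2) $\perp^{\text{þ}}$ satisfies the local character axiom; (3) there is a strict independence relation on the small subsets of $M$. If $\perp^{\text{þ}}$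 is a strict independence relation, then it is the coarsest one: for every strict independence relation $\perp$, $A\perp_CB$ implies $A\perp^{\text{þ}}_CB$. -/

import Mathlib

open FirstOrder Cardinal

universe u v w t

namespace Independence

variable (L : FirstOrder.Language.{u, v}) {M : Type w} [L.Structure M]

/-- `sorts` exhibits `M` as a many-sorted structure: every `sorts s` is definable without
parameters, and every element of `M` lies in exactly one sort. A many-sorted structure (for instance
the structure of imaginaries `M^eq`) is viewed in this way as the disjoint union of its sorts.
An ordinary one-sorted structure has one sort, all of `M`. -/
structure IsSorting {S : Type t} (sorts : S → Set M) : Prop where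
  definable : ∀ s, (∅ : Set M).Definable₁ L (sorts s)
  existsUnique : ∀ a : M, ∃! s, a ∈ sorts s

/-- `κ`-saturation: a set of formulas in one variable, which belongs to one of the sorts, with
parameters from a set `A` of cardinality `< κ`, is realised in `M` if it is finitely satisfiable
in `M`. -/
def IsSaturated (κ : Cardinal.{w}) {S : Type t} (sorts : S → Set M) : Prop :=
  ∀ (A : Set M), #A < κ → ∀ (s : S) (Γ : Set (L.Formula (A ⊕ Unit))),
    (∀ Γ₀ : Finset (L.Formula (A ⊕ Unit)), (Γ₀ : Set (L.Formula (A ⊕ Unit))) ⊆ Γ →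
      ∃ m ∈ sorts s, ∀ φ ∈ Γ₀, φ.Realize (Sum.elim (fun a : A => (a : M)) (fun _ => m))) →
    ∃ m ∈ sorts s, ∀ φ ∈ Γ, φ.Realize (Sum.elim (fun a : A => (a : M)) (fun _ => m))

/-- Strong `κ`-homogeneity: an elementary map from a subset of cardinality `< κ` to `M` extends
to an automorphism of `M`. -/
def IsStronglyHomogeneous (M : Type w) [L.Structure M] (κ : Cardinal.{w}) : Prop :=
  ∀ (A : Set M), #A < κ → ∀ f : A → M,
    (∀ φ : L.Formula A, φ.Realize (fun a : A => (a : M)) ↔ φ.Realize f) →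
    ∃ σ : M ≃[L] M, ∀ a : A, σ (a : M) = f a

variable {L} in
/-- `M`, with the given sorts, is a big model of the theory `T`, where "small" means "of cardinality
less than the strongly inaccessible cardinal `κ`". The case of a class-sized big model with
set-sized small subsets is `κ = Cardinal.univ`. -/
structure IsBigModel (T : L.Theory) (κ : Cardinal.{w}) {S : Type t} (sorts : S → Set M) :
    Prop where
  models : M ⊨ T
  inaccessible : κ.IsInaccessible
  card_lt : Cardinal.lift.{w} L.card < Cardinal.lift.{max u v} κ
  sorting : IsSorting L sorts
  saturated : IsSaturated L κ sorts
  homogeneous : IsStronglyHomogeneous L M κ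

/-- Algebraic closure: the union of all finite sets definable over `A`. -/
def acl (A : Set M) : Set M :=
  {a | ∃ D : Set M, A.Definable₁ L D ∧ D.Finite ∧ a ∈ D}

/-- `A ≡_C A'`: some automorphism fixes `C` pointwise and maps the set `A` onto the set `A'`. -/
def EquivOver (C A A' : Set M) : Prop :=
  ∃ σ : M ≃[L] M, (∀ c ∈ C, σ c = c) ∧ σ '' A = A'

/-- A ternary relation between subsets; `R A C B` stands for "`A` is independent from `B` over
`C`". Only its values on small subsets matter. -/
abbrev TernaryRel (M : Type w) : Type w := Set M → Set M → Set M → Prop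

section Axioms

variable (κ : Cardinal.{w}) (R : TernaryRel M)

def Invariance : Prop :=
  ∀ A B C : Set M, #A < κ → #B < κ → #C < κ → R A C B →
    ∀ σ : M ≃[L] M, R (σ '' A) (σ '' C) (σ '' B)

def Monotonicity : Prop :=
  ∀ A B C A' B' : Set M, #A < κ → #B < κ → #C < κ → R A C B → A' ⊆ A → B' ⊆ B → R A' C B'

def BaseMonotonicity : Prop :=
  ∀ A B C D : Set M, #A < κ → #B < κ → D ⊆ C → C ⊆ B → R A D B → R A C B

def Transitivity : Prop :=
  ∀ A B C D : Set M, #A < κ → #B < κ → D ⊆ C → C ⊆ B → R B C A → R C D A → R B D A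

def Normality : Prop :=
  ∀ A B C : Set M, #A < κ → #B < κ → #C < κ → R A C B → R (A ∪ C) C B

def Extension : Prop :=
  ∀ A B C B' : Set M, #A < κ → #C < κ → #B' < κ → R A C B → B ⊆ B' →
    ∃ A' : Set M, EquivOver L (B ∪ C) A A' ∧ R A' C B'

def FiniteCharacter : Prop :=
  ∀ A B C : Set M, #A < κ → #B < κ → #C < κ →
    (∀ A₀ : Set M, A₀ ⊆ A → A₀.Finite → R A₀ C B) → R A C B

/-- The cardinal `μ`, like all cardinals that are spoken of in the big model, is small. -/
def LocalCharacter : Prop :=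
  ∀ A : Set M, #A < κ → ∃ μ : Cardinal.{w}, μ < κ ∧
    ∀ B : Set M, #B < κ → ∃ C : Set M, C ⊆ B ∧ #C < μ ∧ R A C B

def AntiReflexivity : Prop :=
  ∀ (a : M) (B : Set M), #B < κ → R {a} B {a} → a ∈ acl L B

structure IsIndependenceRelation : Prop where
  invariance : Invariance L κ R
  monotonicity : Monotonicity κ R
  baseMonotonicity : BaseMonotonicity κ R
  transitivity : Transitivity κ R
  normality : Normality κ R
  extension : Extension L κ R
  finiteCharacter : FiniteCharacter κ R
  localCharacter : LocalCharacter κ R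

structure IsStrictIndependenceRelation : Prop extends IsIndependenceRelation L κ R where
  antiReflexivity : AntiReflexivity L κ R

/-- The relation `R*` ("forking") derived from the relation `R` ("dividing"). -/
def star : TernaryRel M := fun A C B =>
  ∀ B' : Set M, #B' < κ → B ⊆ B' → ∃ A' : Set M, EquivOver L (B ∪ C) A A' ∧ R A' C B'

end Axioms

/-- M-dividing independence. -/
def mIndep : TernaryRel M := fun A C B =>
  ∀ C' : Set M, C ⊆ C' → C' ⊆ acl L (B ∪ C) →
    acl L (A ∪ C') ∩ acl L (B ∪ C') = acl L C'

/-- Thorn-forking independence. -/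
def thornIndep (κ : Cardinal.{w}) : TernaryRel M := star L κ (mIndep L)

/-- `R` is finer than `R'` (and `R'` coarser than `R`), as relations between small subsets. -/
def IsFinerThan (κ : Cardinal.{w}) (R R' : TernaryRel M) : Prop :=
  ∀ A B C : Set M, #A < κ → #B < κ → #C < κ → R A C B → R' A C B

end Independence

namespace Independence

open FirstOrder.Language Set

/-! ### Algebraic closure as a closure operator that commutes with automorphisms. -/

section AlgebraicClosure

variable {L : FirstOrder.Language.{u, v}} {M : Type w} [L.Structure M]

/-! M-dividing independence satisfies invariance, monotonicity, base monotonicity, transitivity,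
normality and anti-reflexivity by computing with `acl`. The operation `star` preserves the first
five and forces extension (`extension_star`), because a small set has only a small number of types
over a small set. Anti-reflexivity survives because thorn-forking independence implies M-dividing
independence (`of_star`). Finite character holds by compactness (`finiteCharacter_thornIndep`): a
failure of M-independence is witnessed by one formula. So local character is the only axiom in
doubt, which gives (2) ⇒ (1).

Conversely, let `R` be a strict independence relation. The key fact is that `R` is symmetric
(`symm`): local character is applied to `B` over a long sequence of conjugates of `A`. By symmetry
and anti-reflexivity, an element of `acl (A ∪ C') ∩ acl (B ∪ C')` is independent from itself over
`C'`, hence lies in `acl C'`; so `R` implies M-dividing independence. By extension for `R` it also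
implies thorn-forking independence. This is the coarsest property, and local character passes to
coarser relations, which gives (3) ⇒ (2). -/

theorem definable₁_range_iff {α : Type*} {v : α → M} {D : Set M} :
    (range v).Definable₁ L D ↔
      ∃ φ : L.Formula (α ⊕ Unit), D = {x | φ.Realize (Sum.elim v fun _ => x)} := by
  rw [Set.Definable₁, definable_iff_exists_formula_sum]
  constructor
  · rintro ⟨φ, hφ⟩
    choose f hf using fun a : range v => a.2
    refine ⟨φ.relabel (Sum.map f fun _ => ()), ?_⟩
    ext x
    have := Set.ext_iff.1 hφ fun _ => x
    simp only [mem_ofPred_eq] at this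
    simp only [mem_ofPred_eq, Formula.realize_relabel, this]
    apply iff_of_eq
    congr 1
    ext i
    cases i <;> simp [hf]
  · rintro ⟨φ, rfl⟩
    refine ⟨φ.relabel (Sum.map (rangeFactorization v) fun _ => 0), ?_⟩
    ext x
    simp only [mem_ofPred_eq, Formula.realize_relabel]
    apply iff_of_eq
    congr 1
    ext i
    cases i <;> simp

theorem mem_acl_range_iff {α : Type*} {v : α → M} {a : M} :
    a ∈ acl L (range v) ↔ ∃ φ : L.Formula (α ⊕ Unit),
      φ.Realize (Sum.elim v fun _ => a) ∧
        {x | φ.Realize (Sum.elim v fun _ => x)}.Finite := by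
  constructor
  · rintro ⟨D, hD, hfin, ha⟩
    obtain ⟨φ, rfl⟩ := definable₁_range_iff.1 hD
    exact ⟨φ, ha, hfin⟩
  · rintro ⟨φ, ha, hfin⟩
    exact ⟨_, definable₁_range_iff.2 ⟨φ, rfl⟩, hfin, ha⟩

theorem mem_acl_iff {A : Set M} {a : M} :
    a ∈ acl L A ↔ ∃ φ : L.Formula (A ⊕ Unit),
      φ.Realize (Sum.elim (fun a : A => (a : M)) fun _ => a) ∧
        {x | φ.Realize (Sum.elim (fun a : A => (a : M)) fun _ => x)}.Finite := by
  simpa using mem_acl_range_iff (L := L) (v := fun a : A => (a : M)) (a := a)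

theorem acl_mono {A B : Set M} (h : A ⊆ B) : acl L A ⊆ acl L B := by
  rintro a ⟨D, hD, hfin, ha⟩
  exact ⟨D, hD.mono h, hfin, ha⟩

theorem subset_acl (A : Set M) : A ⊆ acl L A := fun a ha =>
  ⟨{a}, Definable.singleton_of_mem L ha, finite_singleton a, rfl⟩

theorem exists_finite_of_mem_acl {A : Set M} {a : M} (h : a ∈ acl L A) :
    ∃ A₀ ⊆ A, A₀.Finite ∧ a ∈ acl L A₀ := by
  obtain ⟨D, hD, hfin, ha⟩ := h
  obtain ⟨A₀, h₀, hD₀⟩ := definable_iff_finitely_definable.1 hD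
  exact ⟨A₀, h₀, A₀.finite_toSet, D, hD₀, hfin, ha⟩

/-- The formula stating that `φ` has at most `n` solutions in its last variable. -/
noncomputable def solutionsLe {α : Type*} (φ : L.Formula (α ⊕ Unit)) (n : ℕ) : L.Formula α :=
  Formula.iAlls (Fin (n + 1))
    ((Formula.iInf fun i : Fin (n + 1) =>
        φ.relabel (Sum.map id fun _ => i : α ⊕ Unit → α ⊕ Fin (n + 1))).imp
      (Formula.iSup fun p : {p : Fin (n + 1) × Fin (n + 1) // p.1 ≠ p.2} =>
        Term.equal (Term.var (Sum.inr p.1.1)) (Term.var (Sum.inr p.1.2))))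

theorem realize_solutionsLe {α : Type*} {φ : L.Formula (α ⊕ Unit)} {n : ℕ} {v : α → M} :
    (solutionsLe φ n).Realize v ↔
      {x | φ.Realize (Sum.elim v fun _ => x)}.encard ≤ n := by
  have key : (solutionsLe φ n).Realize v ↔ ∀ f : Fin (n + 1) → M,
      (∀ i, φ.Realize (Sum.elim v fun _ => f i)) → ¬ Function.Injective f := by
    have h (f : Fin (n + 1) → M) (i : Fin (n + 1)) :
        Sum.elim v f ∘ (Sum.map id fun _ => i : α ⊕ Unit → α ⊕ Fin (n + 1)) =
          Sum.elim v fun _ => f i := by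
      ext j
      cases j <;> rfl
    simp only [solutionsLe, Formula.realize_iAlls, Formula.realize_imp, Formula.realize_iInf,
      Formula.realize_relabel, Formula.realize_iSup, Formula.realize_equal, Term.realize_var,
      Sum.elim_inr]
    refine forall_congr' fun f => ?_
    have e : (fun a => Sum.elim v f a) = Sum.elim v f := rfl
    simp only [e, h, Function.Injective, not_forall]
    refine imp_congr_right fun _ => ?_
    constructor
    · rintro ⟨⟨⟨i, j⟩, hij⟩, hf⟩
      exact ⟨i, j, hf, hij⟩
    · rintro ⟨i, j, hf, hij⟩
      exact ⟨⟨⟨i, j⟩, hij⟩, hf⟩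
  rw [key]
  constructor
  · intro h
    by_contra hlt
    have : ((n + 1 : ℕ) : ℕ∞) ≤ {x | φ.Realize (Sum.elim v fun _ => x)}.encard := by
      rw [Nat.cast_add, Nat.cast_one]
      exact Order.add_one_le_of_lt (not_le.1 hlt)
    obtain ⟨s, hs, hcard⟩ := exists_subset_encard_eq this
    have hfin : s.Finite := finite_of_encard_eq_coe hcard
    have : Nat.card s = n + 1 := by
      rw [Nat.card_coe_set_eq]
      rw [Set.ncard, hcard, ENat.toNat_natCast]
    have := hfin.to_subtype
    let e := (Finite.equivFinOfCardEq ‹Nat.card s = n + 1›).symm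
    exact h (fun i => e i) (fun i => hs (e i).2) (Subtype.val_injective.comp e.injective)
  · intro h f hf hinj
    have h₁ : (range f).encard ≤ n :=
      (encard_le_encard (range_subset_iff.2 hf)).trans h
    rw [← image_univ, hinj.encard_image, encard_univ, ENat.card_eq_coe_fintype_card,
      Fintype.card_fin] at h₁
    norm_cast at h₁
    omega

/-- If `a` satisfies an algebraic formula `φ` over finitely many `b ∈ acl A`, quantify the `b` out,
restricting each to its own algebraic formula `ε b`. For other such tuples `φ` may have infinitely
many solutions, so `ψ` also imposes the bound `n`; its solution set is then a finite union of finite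
sets. -/
theorem acl_acl (A : Set M) : acl L (acl L A) = acl L A := by
  refine subset_antisymm (fun a ha => ?_) (subset_acl _)
  obtain ⟨B, hB, hBfin, ha⟩ := exists_finite_of_mem_acl ha
  have := hBfin.to_subtype
  obtain ⟨φ, haφ, hfin⟩ := mem_acl_iff.1 ha
  choose ε hε hεfin using fun b : B => mem_acl_iff.1 (hB b.2)
  let n := {x | φ.Realize (Sum.elim (fun b : B => (b : M)) fun _ => x)}.ncard
  let ψ : L.Formula (A ⊕ Unit) := Formula.iExs B
    ((Formula.iInf fun b : B =>
        (ε b).relabel (Sum.elim (Sum.inl ∘ Sum.inl) fun _ => Sum.inr b :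
          A ⊕ Unit → (A ⊕ Unit) ⊕ B)) ⊓
      ((solutionsLe φ n).relabel (Sum.inr : B → (A ⊕ Unit) ⊕ B) ⊓
        φ.relabel (Sum.elim Sum.inr fun _ => Sum.inl (Sum.inr ()) :
          B ⊕ Unit → (A ⊕ Unit) ⊕ B)))
  have hψ (x : M) : ψ.Realize (Sum.elim (fun a : A => (a : M)) fun _ => x) ↔
      ∃ y : B → M,
        (∀ b, (ε b).Realize (Sum.elim (fun a : A => (a : M)) fun _ => y b)) ∧
        {x | φ.Realize (Sum.elim y fun _ => x)}.encard ≤ n ∧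
          φ.Realize (Sum.elim y fun _ => x) := by
    simp only [ψ, Formula.realize_iExs, Formula.realize_inf, Formula.realize_iInf,
      Formula.realize_relabel, realize_solutionsLe]
    refine exists_congr fun y => and_congr (forall_congr' fun b => ?_) (and_congr ?_ ?_)
    · apply iff_of_eq
      congr 1
      ext i
      cases i <;> rfl
    · rfl
    · apply iff_of_eq
      congr 1
      ext i
      cases i <;> rfl
  refine mem_acl_iff.2 ⟨ψ, (hψ a).2 ⟨fun b => b, hε, ?_, haφ⟩, ?_⟩
  · exact (hfin.cast_ncard_eq).ge
  · refine ((Finite.pi' hεfin).biUnion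
      (t := fun y => {x | {x | φ.Realize (Sum.elim y fun _ => x)}.encard ≤ n ∧
        φ.Realize (Sum.elim y fun _ => x)}) fun y _ => ?_).subset fun x hx => ?_
    · by_cases h : {x | φ.Realize (Sum.elim y fun _ => x)}.encard ≤ n
      · exact (finite_of_encard_le_coe h).subset fun x hx => hx.2
      · simp [h]
    · obtain ⟨y, hy, h⟩ := (hψ x).1 hx
      exact mem_biUnion (x := y) hy h

theorem acl_subset_acl {A B : Set M} (h : A ⊆ acl L B) : acl L A ⊆ acl L B :=
  (acl_mono h).trans (acl_acl B).subset

theorem acl_union_acl (A B : Set M) : acl L (A ∪ acl L B) = acl L (A ∪ B) :=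
  subset_antisymm
    (acl_subset_acl (union_subset (subset_union_left.trans (subset_acl _))
      (acl_mono subset_union_right)))
    (acl_mono (union_subset_union_right A (subset_acl B)))

theorem realize_equiv_comp (σ : M ≃[L] M) {α : Type*} (φ : L.Formula α) (v : α → M) :
    φ.Realize (fun a => σ (v a)) ↔ φ.Realize v :=
  StrongHomClass.realize_formula σ φ

theorem image_acl_subset (σ : M ≃[L] M) (A : Set M) : σ '' acl L A ⊆ acl L (σ '' A) := by
  rintro _ ⟨a, ha, rfl⟩
  obtain ⟨φ, haφ, hfin⟩ := mem_acl_iff.1 ha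
  have hr : σ '' A = range fun a : A => σ a := by
    rw [← image_eq_range]
  have h (x : M) : φ.Realize (Sum.elim (fun a : A => σ a) fun _ => σ x) ↔
      φ.Realize (Sum.elim (fun a : A => (a : M)) fun _ => x) := by
    rw [← realize_equiv_comp σ _ (Sum.elim (fun a : A => (a : M)) fun _ => x)]
    apply iff_of_eq
    congr 1
    ext i
    cases i <;> rfl
  rw [hr, mem_acl_range_iff]
  refine ⟨φ, (h a).2 haφ, (hfin.image σ).subset fun x hx => ?_⟩
  obtain ⟨x, rfl⟩ := σ.surjective x
  exact mem_image_of_mem _ ((h x).1 hx)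

theorem image_symm_image (σ : M ≃[L] M) (A : Set M) : σ.symm '' (σ '' A) = A := by
  rw [image_image]
  simp

theorem image_image_symm (σ : M ≃[L] M) (A : Set M) : σ '' (σ.symm '' A) = A := by
  rw [image_image]
  simp

theorem image_acl (σ : M ≃[L] M) (A : Set M) : σ '' acl L A = acl L (σ '' A) := by
  refine subset_antisymm (image_acl_subset σ A) ?_
  have := image_mono (f := σ) (image_acl_subset σ.symm (σ '' A))
  rwa [image_symm_image, image_image_symm] at this

theorem image_comp_equiv (σ τ : M ≃[L] M) (A : Set M) : τ.comp σ '' A = τ '' (σ '' A) := by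
  rw [image_image]
  rfl

theorem image_eq_of_fixes {σ : M ≃[L] M} {A B : Set M} (h : ∀ a ∈ B, σ a = a) (hA : A ⊆ B) :
    σ '' A = A := by
  rw [image_congr fun a ha => h a (hA ha), image_id']

theorem symm_fixes {σ : M ≃[L] M} {B : Set M} (h : ∀ a ∈ B, σ a = a) :
    ∀ a ∈ B, σ.symm a = a := fun a ha => by
  conv_lhs => rw [← h a ha]
  simp

theorem EquivOver.symm {C A A' : Set M} (h : EquivOver L C A A') : EquivOver L C A' A := by
  obtain ⟨σ, hσ, rfl⟩ := h
  exact ⟨σ.symm, symm_fixes hσ, image_symm_image σ A⟩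

end AlgebraicClosure

end Independence

namespace Independence

open FirstOrder.Language Set Filter

/-! ### Smallness, homogeneity and saturation in a big model. -/

section BigModel

variable {L : FirstOrder.Language.{u, v}} {M : Type w} [L.Structure M]
  {T : L.Theory} {κ : Cardinal.{w}} {S : Type t} {sorts : S → Set M}

namespace IsBigModel

section Smallness

theorem small_union (hM : IsBigModel T κ sorts) {A B : Set M} (hA : #A < κ) (hB : #B < κ) :
    #(A ∪ B : Set M) < κ :=
  (mk_union_le A B).trans_lt (add_lt_of_lt hM.inaccessible.aleph0_lt.le hA hB)

theorem small_of_finite (hM : IsBigModel T κ sorts) {A : Set M} (hA : A.Finite) : #A < κ :=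
  hA.lt_aleph0.trans hM.inaccessible.aleph0_lt

theorem small_iUnion (hM : IsBigModel T κ sorts) {ι : Type w} (hι : #ι < κ) {f : ι → Set M}
    (hf : ∀ i, #(f i) < κ) : #(⋃ i, f i) < κ :=
  (card_iUnion_lt_iff_forall_of_isRegular hM.inaccessible.isRegular hι).2 hf

theorem small_sum (hM : IsBigModel T κ sorts) {α β : Type w} (hα : #α < κ) (hβ : #β < κ) :
    #(α ⊕ β) < κ := by
  simpa using add_lt_of_lt hM.inaccessible.aleph0_lt.le hα hβ

theorem small_image {A : Set M} (hA : #A < κ) (f : M → M) : #(f '' A) < κ :=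
  mk_image_le.trans_lt hA

theorem small_subset {A B : Set M} (hB : #B < κ) (h : A ⊆ B) : #A < κ :=
  (mk_le_mk_of_subset h).trans_lt hB

theorem card_formula_lt (hM : IsBigModel T κ sorts) {α : Type w} (hα : #α < κ) :
    #(L.Formula α) < Cardinal.lift.{max u v} κ := by
  have h₁ : #(L.Formula α) ≤ #(Σ n, L.BoundedFormula α n) :=
    mk_le_of_injective (f := fun φ => ⟨0, φ⟩) fun φ ψ h => by simpa using h
  refine (h₁.trans BoundedFormula.card_le).trans_lt (max_lt ?_ (add_lt_of_lt ?_ ?_ ?_))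
  · exact aleph0_lt_lift.2 hM.inaccessible.aleph0_lt
  · exact aleph0_le_lift.2 hM.inaccessible.aleph0_lt.le
  · exact Cardinal.lift_lt.2 hα
  · exact hM.card_lt

/-- There are fewer than `κ` formulas and `κ` is a strong limit, so there are fewer than `κ` types.
-/
theorem small_of_injective_set_formula (hM : IsBigModel T κ sorts) {α Q : Type w} (hα : #α < κ)
    {f : Q → Set (L.Formula α)} (hf : Function.Injective f) : #Q < κ := by
  have h₁ := hM.card_formula_lt hα
  obtain ⟨ν, hν, h₂⟩ := Cardinal.lt_lift_iff.1 h₁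
  have h₃ := Cardinal.lift_mk_le_lift_mk_of_injective hf
  rw [mk_set, ← h₂, ← Cardinal.lift_two.{max u v, w}, ← Cardinal.lift_power, Cardinal.lift_lift,
    Cardinal.lift_umax.{w, max u v}] at h₃
  exact (Cardinal.lift_le.1 h₃).trans_lt (hM.inaccessible.isStrongPrelimit hν)

theorem small_acl (hM : IsBigModel T κ sorts) {A : Set M} (hA : #A < κ) : #(acl L A) < κ := by
  choose φ hφ hfin using fun a : acl L A => mem_acl_iff.1 a.2
  -- Grouping elements by their chosen formula indexes the formulas in use by a type in the universe
  -- of `M`, where `κ` lives.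
  let q : acl L A → Quotient (Setoid.ker φ) := Quotient.mk _
  have hQ : #(Quotient (Setoid.ker φ)) < κ := by
    refine hM.small_of_injective_set_formula (α := A ⊕ Unit) ?_ (f := fun p => {φ p.out})
      fun p q h => Quotient.out_equiv_out.1 (singleton_injective h)
    simpa using add_lt_of_lt hM.inaccessible.aleph0_lt.le hA (hM.inaccessible.nat_lt 1)
  have : acl L A ⊆ ⋃ p : Quotient (Setoid.ker φ),
      {x | (φ p.out).Realize (Sum.elim (fun a : A => (a : M)) fun _ => x)} := by
    intro a ha
    refine mem_iUnion.2 ⟨q ⟨a, ha⟩, ?_⟩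
    have : φ (q ⟨a, ha⟩).out = φ ⟨a, ha⟩ := Quotient.mk_out (s := Setoid.ker φ) _
    simp only [mem_ofPred_eq, this]
    exact hφ ⟨a, ha⟩
  exact small_subset (hM.small_iUnion hQ fun p => hM.small_of_finite (hfin _)) this

end Smallness

section Homogeneity

theorem exists_equiv_of_realize_iff (hM : IsBigModel T κ sorts) {α : Type w} (hα : #α < κ)
    {v v' : α → M} (h : ∀ φ : L.Formula α, φ.Realize v ↔ φ.Realize v') :
    ∃ σ : M ≃[L] M, ∀ a, σ (v a) = v' a := by
  choose f hf using fun a : range v => a.2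
  have hv' (a : α) : v' (f ⟨v a, mem_range_self a⟩) = v' a := by
    have := h (Term.equal (Term.var (f ⟨v a, mem_range_self a⟩)) (Term.var a))
    simpa [hf] using this
  obtain ⟨σ, hσ⟩ := hM.homogeneous (range v) (mk_range_le.trans_lt hα) (fun a => v' (f a))
    fun φ => by
      have := h (φ.relabel f)
      simp only [Formula.realize_relabel] at this
      have e : v ∘ f = fun a : range v => (a : M) := by
        ext a
        exact hf a
      rwa [e] at this
  exact ⟨σ, fun a => (hσ ⟨v a, mem_range_self a⟩).trans (hv' a)⟩

end Homogeneity

section Saturation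

theorem exists_realize (hM : IsBigModel T κ sorts) {α : Type w} (hα : #α < κ) (v : α → M) (s : S)
    (Γ : Set (L.Formula (α ⊕ Unit)))
    (h : ∀ Γ₀ : Finset (L.Formula (α ⊕ Unit)), (Γ₀ : Set (L.Formula (α ⊕ Unit))) ⊆ Γ →
      ∃ m ∈ sorts s, ∀ φ ∈ Γ₀, φ.Realize (Sum.elim v fun _ => m)) :
    ∃ m ∈ sorts s, ∀ φ ∈ Γ, φ.Realize (Sum.elim v fun _ => m) := by
  classical
  let r : L.Formula (α ⊕ Unit) → L.Formula (range v ⊕ Unit) := fun φ =>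
    φ.relabel (Sum.map (rangeFactorization v) id)
  have hr (φ : L.Formula (α ⊕ Unit)) (m : M) :
      (r φ).Realize (Sum.elim (fun a : range v => (a : M)) fun _ => m) ↔
        φ.Realize (Sum.elim v fun _ => m) := by
    simp only [r, Formula.realize_relabel]
    apply iff_of_eq
    congr 1
    ext i
    cases i <;> rfl
  obtain ⟨m, hm, h'⟩ := hM.saturated (range v) (mk_range_le.trans_lt hα) s (r '' Γ)
    fun Γ₁ h₁ => by
      obtain ⟨Γ₀, h₀, rfl⟩ := Finset.subset_set_image_iff.1 h₁
      obtain ⟨m, hm, h'⟩ := h Γ₀ h₀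
      refine ⟨m, hm, fun φ hφ => ?_⟩
      obtain ⟨ψ, hψ, rfl⟩ := Finset.mem_image.1 hφ
      exact (hr ψ m).2 (h' ψ hψ)
  exact ⟨m, hm, fun φ hφ => (hr φ m).1 (h' _ (mem_image_of_mem r hφ))⟩

theorem exists_formula_sort (hM : IsBigModel T κ sorts) (s : S) (α : Type*) :
    ∃ φ : L.Formula (α ⊕ Unit), ∀ (v : α → M) (m : M),
      φ.Realize (Sum.elim v fun _ => m) ↔ m ∈ sorts s := by
  have h := hM.sorting.definable s
  rw [← range_eq_empty (Empty.elim : Empty → M), definable₁_range_iff] at h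
  obtain ⟨φ, hφ⟩ := h
  refine ⟨φ.relabel (Sum.map Empty.elim id), fun v m => ?_⟩
  rw [hφ, Formula.realize_relabel, mem_ofPred_eq]
  apply iff_of_eq
  congr 1
  ext i
  rcases i with i | i
  · exact i.elim
  · rfl

theorem image_sort (hM : IsBigModel T κ sorts) (σ : M ≃[L] M) (s : S) {m : M} :
    σ m ∈ sorts s ↔ m ∈ sorts s := by
  obtain ⟨φ, hφ⟩ := hM.exists_formula_sort s Empty
  rw [← hφ (fun i => σ i.elim) (σ m), ← hφ Empty.elim m,
    ← realize_equiv_comp σ _ (Sum.elim Empty.elim fun _ => m)]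
  apply iff_of_eq
  congr 1
  ext i
  rcases i with i | i
  · exact i.elim
  · rfl

/-- A formula mentions finitely many coordinates, so it lives on the initial segment ending at the
largest of them, where `hJ` applies. If it mentions none, its truth does not depend on `ω`. -/
theorem exists_tuple_of_exists_extension {Ω : Type*} {𝓕 : Filter Ω} [𝓕.NeBot] {α I : Type w}
    [LinearOrder I] {v : α → M} {F : Ω → I → M} {g : I → M} {J : Set I}
    (hJ : ∀ j ∈ J, ∀ φ : L.Formula ((α ⊕ Iio j) ⊕ Unit),
      (∀ᶠ ω in 𝓕, φ.Realize (Sum.elim (Sum.elim v fun k => F ω k) fun _ => F ω j)) →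
        φ.Realize (Sum.elim (Sum.elim v fun k => g k) fun _ => g j))
    (φ : L.Formula (α ⊕ J))
    (hφ : ∀ᶠ ω in 𝓕, φ.Realize (Sum.elim v fun k => F ω k)) :
    φ.Realize (Sum.elim v fun k => g k) := by
  classical
  by_cases hne : (φ.freeVarFinset.toRight).Nonempty
  · let j := φ.freeVarFinset.toRight.max' hne
    have hj (k : J) (hk : Sum.inr k ∈ φ.freeVarFinset) : k ≤ j :=
      Finset.le_max' _ _ (by simpa using hk)
    let r : φ.freeVarFinset → (α ⊕ Iio (j : I)) ⊕ Unit := fun x =>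
      match x with
      | ⟨Sum.inl a, _⟩ => Sum.inl (Sum.inl a)
      | ⟨Sum.inr k, hk⟩ => if h : k = j then Sum.inr () else
          Sum.inl (Sum.inr ⟨k, lt_of_le_of_ne (hj k hk) fun e => h (Subtype.ext e)⟩)
    have hr (f : I → M) : Formula.Realize (φ.restrictFreeVar r)
        (Sum.elim (Sum.elim v fun k => f k) fun _ => f j) ↔
          φ.Realize (Sum.elim v fun k => f k) := by
      refine BoundedFormula.realize_restrictFreeVar _ ?_
      rintro ⟨a | k, hk⟩
      · rfl
      · by_cases h : k = j
        · simp [r, h]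
        · simp [r, h]
    rw [← hr]
    exact hJ j j.2 _ (hφ.mono fun ω hω => (hr _).2 hω)
  · obtain ⟨ω, hω⟩ := hφ.exists
    let r : φ.freeVarFinset → α := fun x =>
      match x with
      | ⟨Sum.inl a, _⟩ => a
      | ⟨Sum.inr k, hk⟩ => (hne ⟨k, by simpa using hk⟩).elim
    have hr (f : I → M) : Formula.Realize (φ.restrictFreeVar r) v ↔
          φ.Realize (Sum.elim v fun k => f k) := by
      refine BoundedFormula.realize_restrictFreeVar _ ?_
      rintro ⟨a | k, hk⟩
      · rfl
      · exact (hne ⟨k, by simpa using hk⟩).elim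
    exact (hr g).1 ((hr (F ω)).2 hω)

/-- A big model realises all limits of types of small tuples. -/
theorem exists_tuple_of_eventually (hM : IsBigModel T κ sorts) {Ω : Type*} (𝓕 : Filter Ω)
    [𝓕.NeBot] {α I : Type w} (hα : #α < κ) (hI : #I < κ) (v : α → M) (F : Ω → I → M)
    (hF : ∀ i, ∃ s, ∀ᶠ ω in 𝓕, F ω i ∈ sorts s) :
    ∃ g : I → M, ∀ φ : L.Formula (α ⊕ I),
      (∀ᶠ ω in 𝓕, φ.Realize (Sum.elim v (F ω))) → φ.Realize (Sum.elim v g) := by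
  classical
  obtain ⟨ω₀, -⟩ := 𝓕.nonempty_of_mem univ_mem
  let _ : LinearOrder I := linearOrderOfSTO WellOrderingRel
  have hwf : WellFounded ((· < ·) : I → I → Prop) := (inferInstance : IsWellOrder I WellOrderingRel).wf
  let P (i : I) (g : ∀ j, j < i → M) (m : M) : Prop :=
    ∀ φ : L.Formula ((α ⊕ Iio i) ⊕ Unit),
      (∀ᶠ ω in 𝓕, φ.Realize (Sum.elim (Sum.elim v fun k => F ω k) fun _ => F ω i)) →
        φ.Realize (Sum.elim (Sum.elim v fun k => g k k.2) fun _ => m)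
  -- The tuple is built along a well-order of `I`; `key` shows that the default `F ω₀ i` is never
  -- taken.
  let g : I → M := hwf.fix fun i g => if h : ∃ m, P i g m then h.choose else F ω₀ i
  have hg (i : I) (h : ∃ m, P i (fun j _ => g j) m) : P i (fun j _ => g j) (g i) := by
    have e : g i = h.choose := by
      rw [show g i = _ from hwf.fix_eq _ i]
      exact dif_pos h
    rw [e]
    exact h.choose_spec
  have key (i : I) : P i (fun j _ => g j) (g i) := by
    induction i using hwf.induction with
    | _ i ih =>
      refine hg i ?_
      obtain ⟨s, hs⟩ := hF i
      obtain ⟨θ, hθ⟩ := hM.exists_formula_sort s (α ⊕ Iio i)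
      obtain ⟨m, -, hm⟩ := hM.exists_realize (α := α ⊕ Iio i)
        (hM.small_sum hα ((mk_subtype_le _).trans_lt hI)) (Sum.elim v fun k => g k) s
        {φ | ∀ᶠ ω in 𝓕, φ.Realize (Sum.elim (Sum.elim v fun k => F ω k) fun _ => F ω i)}
        fun Γ₀ h₀ => by
          -- Finite satisfiability is a property `ψ` of the earlier coordinates alone. It holds
          -- eventually for `F`, hence for `g` by induction.
          let ψ : L.Formula (α ⊕ Iio i) :=
            Formula.iExs Unit (θ ⊓ Formula.iInf fun φ : Γ₀ => (φ : L.Formula ((α ⊕ Iio i) ⊕ Unit)))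
          have hψ (y : α ⊕ Iio i → M) : ψ.Realize y ↔ ∃ m ∈ sorts s, ∀ φ ∈ Γ₀,
              Formula.Realize φ (Sum.elim y fun _ => m) := by
            simp only [ψ, Formula.realize_iExs, Formula.realize_inf, Formula.realize_iInf]
            constructor
            · rintro ⟨m, h, h'⟩
              exact ⟨m (), (hθ y (m ())).1 h, fun φ hφ => h' ⟨φ, hφ⟩⟩
            · rintro ⟨m, h, h'⟩
              exact ⟨fun _ => m, (hθ y m).2 h, fun φ => h' φ φ.2⟩
          refine (hψ _).1 (exists_tuple_of_exists_extension (𝓕 := 𝓕) (F := F) ih ψ ?_)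
          have := (Filter.eventually_all_finset Γ₀).2 h₀
          filter_upwards [hs, this] with ω h₁ h₂
          exact (hψ _).2 ⟨F ω i, h₁, h₂⟩
      exact ⟨m, hm⟩
  refine ⟨g, fun φ hφ => ?_⟩
  let e : α ⊕ I → α ⊕ (univ : Set I) := Sum.map id fun i => ⟨i, trivial⟩
  have he (f : I → M) : (φ.relabel e).Realize (Sum.elim v fun k => f k) ↔
      φ.Realize (Sum.elim v f) := by
    rw [Formula.realize_relabel]
    apply iff_of_eq
    congr 1
    ext i
    cases i <;> rfl
  rw [← he]
  exact exists_tuple_of_exists_extension (𝓕 := 𝓕) (F := F) (fun j _ => key j) _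
    (hφ.mono fun ω hω => (he _).2 hω)

end Saturation

end IsBigModel

end BigModel

end Independence

namespace Independence

open FirstOrder.Language Set Filter

/-! ### The axioms that hold for M-dividing independence. -/

section MDividing

variable {L : FirstOrder.Language.{u, v}} {M : Type w} [L.Structure M]

theorem mIndep_iff {A B C : Set M} : mIndep L A C B ↔ ∀ C', C ⊆ C' → C' ⊆ acl L (B ∪ C) →
    ∀ e ∈ acl L (A ∪ C'), e ∈ acl L (B ∪ C') → e ∈ acl L C' := by
  refine forall_congr' fun C' => forall_congr' fun _ => forall_congr' fun _ =>
    ⟨fun h e h₁ h₂ => h.subset ⟨h₁, h₂⟩, fun h => ?_⟩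
  exact subset_antisymm (fun e he => h e he.1 he.2)
    (subset_inter (acl_mono subset_union_right) (acl_mono subset_union_right))

theorem mIndep_image {A B C : Set M} (h : mIndep L A C B) (σ : M ≃[L] M) :
    mIndep L (σ '' A) (σ '' C) (σ '' B) := by
  rw [mIndep_iff] at h ⊢
  intro C' h₁ h₂ e h₃ h₄
  obtain ⟨C', rfl⟩ : ∃ D, C' = σ '' D := ⟨σ.symm '' C', (image_image_symm σ C').symm⟩
  obtain ⟨e, rfl⟩ := σ.surjective e
  simp only [← image_union, ← image_acl, image_subset_image_iff σ.injective,
    σ.injective.mem_set_image] at *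
  exact h C' h₁ h₂ e h₃ h₄

theorem mIndep.mono {A A' B B' C : Set M} (h : mIndep L A C B) (hA : A' ⊆ A) (hB : B' ⊆ B) :
    mIndep L A' C B' := by
  rw [mIndep_iff] at h ⊢
  exact fun C' h₁ h₂ e h₃ h₄ => h C' h₁ (h₂.trans (acl_mono (union_subset_union_left _ hB))) e
    (acl_mono (union_subset_union_left _ hA) h₃) (acl_mono (union_subset_union_left _ hB) h₄)

theorem invariance_mIndep (κ : Cardinal.{w}) : Invariance L κ (mIndep L (M := M)) :=
  fun _ _ _ _ _ _ h σ => mIndep_image h σ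

theorem monotonicity_mIndep (κ : Cardinal.{w}) : Monotonicity κ (mIndep L (M := M)) :=
  fun _ _ _ _ _ _ _ _ h hA hB => h.mono hA hB

theorem baseMonotonicity_mIndep (κ : Cardinal.{w}) : BaseMonotonicity κ (mIndep L (M := M)) := by
  intro A B C D _ _ hD hC h
  rw [mIndep_iff] at h ⊢
  refine fun C' h₁ h₂ => h C' (hD.trans h₁) ?_
  rw [union_eq_left.2 hC] at h₂
  exact h₂.trans (acl_mono subset_union_left)

theorem transitivity_mIndep (κ : Cardinal.{w}) : Transitivity κ (mIndep L (M := M)) := by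
  intro A B C D _ _ hD hC hB h
  rw [mIndep_iff] at h hB ⊢
  intro D' h₁ h₂ e h₃ h₄
  -- The quantifier over base sets in `hB` allows the base `C ∪ D'`, which brings `e` down to `acl
  -- (C ∪ D')`; then `h` brings it down to `acl D'`.
  refine h D' h₁ h₂ e (hB (C ∪ D') subset_union_left ?_ e (acl_mono ?_ h₃) (acl_mono ?_ h₄)) h₄
  · exact union_subset (subset_union_right.trans (subset_acl _))
      (h₂.trans (acl_mono (union_subset_union_right _ hD)))
  · exact union_subset_union_right _ subset_union_right
  · exact union_subset_union_right _ subset_union_right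

theorem normality_mIndep (κ : Cardinal.{w}) : Normality κ (mIndep L (M := M)) := by
  intro A B C _ _ _ h
  rw [mIndep_iff] at h ⊢
  intro C' h₁ h₂ e h₃ h₄
  rw [union_assoc, union_eq_right.2 h₁] at h₃
  exact h C' h₁ h₂ e h₃ h₄

theorem mem_acl_of_mIndep_self {a : M} {B : Set M} (h : mIndep L {a} B {a}) : a ∈ acl L B := by
  rw [mIndep_iff] at h
  have : a ∈ acl L ({a} ∪ B) := subset_acl _ (Or.inl rfl)
  exact h B subset_rfl (subset_union_right.trans (subset_acl _)) a this this

end MDividing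

/-! ### From dividing to forking: the axioms for `star` and for thorn-forking. -/

section Star

variable {L : FirstOrder.Language.{u, v}} {M : Type w} [L.Structure M]
  {T : L.Theory} {κ : Cardinal.{w}} {S : Type t} {sorts : S → Set M} {R : TernaryRel M}

namespace IsBigModel

theorem of_star (hinv : Invariance L κ R) {A B C : Set M}
    (hA : #A < κ) (hB : #B < κ) (hC : #C < κ) (h : star L κ R A C B) : R A C B := by
  obtain ⟨_, ⟨σ, hσ, rfl⟩, hR⟩ := h B hB subset_rfl
  have := hinv _ _ _ (small_image hA σ) hB hC hR σ.symm
  rwa [image_symm_image, image_eq_of_fixes (symm_fixes hσ) subset_union_left,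
    image_eq_of_fixes (symm_fixes hσ) subset_union_right] at this

theorem invariance_star (hinv : Invariance L κ R) :
    Invariance L κ (star L κ R) := by
  intro A B C hA hB hC h σ B' hB' hBB'
  obtain ⟨_, ⟨τ, hτ, rfl⟩, hR⟩ := h (σ.symm '' B') (small_image hB' _) (by
    rw [← image_symm_image σ B]
    exact image_mono hBB')
  refine ⟨_, ⟨(σ.comp τ).comp σ.symm, ?_, rfl⟩, ?_⟩
  · rw [← image_union]
    rintro _ ⟨c, hc, rfl⟩
    simp [hτ c hc]
  · have := hinv _ _ _ (small_image hA τ) (small_image hB' _) hC hR σ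
    rwa [image_image_symm, ← image_symm_image σ A, ← image_comp_equiv, ← image_comp_equiv] at this

theorem monotonicity_star (hM : IsBigModel T κ sorts) (hmon : Monotonicity κ R) :
    Monotonicity κ (star L κ R) := by
  intro A B C A' B' hA hB hC h hA' hB' B'' hB'' hBB''
  have hs := hM.small_union hB hB''
  obtain ⟨_, ⟨σ, hσ, rfl⟩, hR⟩ := h (B ∪ B'') hs subset_union_left
  exact ⟨_, ⟨σ, fun c hc => hσ c (union_subset_union_left _ hB' hc), rfl⟩,
    hmon _ _ _ _ _ (small_image hA σ) hs hC hR (image_mono hA') subset_union_right⟩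

theorem baseMonotonicity_star (hbase : BaseMonotonicity κ R) :
    BaseMonotonicity κ (star L κ R) := by
  intro A B C D hA hB hD hC h B' hB' hBB'
  obtain ⟨_, ⟨σ, hσ, rfl⟩, hR⟩ := h B' hB' hBB'
  refine ⟨_, ⟨σ, fun c hc => hσ c (Or.inl ?_), rfl⟩,
    hbase _ _ _ _ (small_image hA σ) hB' hD (hC.trans hBB') hR⟩
  exact hc.elim id fun hc => hC hc

/-- First move `C` by `σ` to be independent from `A'` over `D`, carrying `B` along; then move `σ ''
B` by `τ` over `A ∪ σ '' C`, which leaves the first independence intact. -/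
theorem transitivity_star (hinv : Invariance L κ R)
    (htrans : Transitivity κ R) : Transitivity κ (star L κ R) := by
  intro A B C D hA hB hD hC h₁ h₂ A' hA' hAA'
  obtain ⟨_, ⟨σ, hσ, rfl⟩, hR₁⟩ := h₂ A' hA' hAA'
  have h := invariance_star hinv _ _ _ hB hA (small_subset hB hC) h₁ σ
  rw [image_eq_of_fixes hσ subset_union_left] at h
  obtain ⟨_, ⟨τ, hτ, rfl⟩, hR₂⟩ := h A' hA' hAA'
  have hDC : D ⊆ σ '' C := by
    rw [← image_eq_of_fixes hσ (subset_union_right (s := A))]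
    exact image_mono hD
  refine ⟨τ '' (σ '' B), ⟨τ.comp σ, fun c hc => ?_, image_comp_equiv σ τ B⟩,
    htrans A' _ (σ '' C) D hA' (small_image (small_image hB σ) τ) hDC ?_ hR₂ hR₁⟩
  · rw [Equiv.comp_apply, hσ c hc, hτ c (union_subset_union_right A hDC hc)]
  · conv_lhs => rw [← image_eq_of_fixes hτ (subset_union_right (s := A))]
    exact image_mono (image_mono hC)

theorem normality_star (hnorm : Normality κ R) :
    Normality κ (star L κ R) := by
  intro A B C hA hB hC h B' hB' hBB'
  obtain ⟨_, ⟨σ, hσ, rfl⟩, hR⟩ := h B' hB' hBB'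
  refine ⟨_, ⟨σ, hσ, rfl⟩, ?_⟩
  rw [image_union, image_eq_of_fixes hσ subset_union_right]
  exact hnorm _ _ _ (small_image hA σ) hB' hC hR

/-- If every conjugate of `A` had a bad superset of `B'`, one bad set for each type over `B' ∪ C`
would suffice. Their union is small, and a conjugate independent from it contradicts the badness
chosen for its type. -/
theorem extension_star (hM : IsBigModel T κ sorts) (hmon : Monotonicity κ R) :
    Extension L κ (star L κ R) := by
  intro A B C B' hA hC hB' h hBB'
  by_contra hcon
  have hE := hM.small_union hB' hC
  let G := {σ : M ≃[L] M // ∀ c ∈ B ∪ C, σ c = c}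
  have hbad (σ : G) : ∃ B'' : Set M, #B'' < κ ∧ B' ⊆ B'' ∧
      ∀ A'' : Set M, EquivOver L (B' ∪ C) (σ.1 '' A) A'' → ¬ R A'' C B'' := by
    by_contra hσ
    refine hcon ⟨σ.1 '' A, ⟨σ.1, σ.2, rfl⟩, fun B'' h₁ h₂ => ?_⟩
    by_contra h₃
    exact hσ ⟨B'', h₁, h₂, fun A'' h₄ h₅ => h₃ ⟨A'', h₄, h₅⟩⟩
  choose bad hsmall hsub hbad using hbad
  let tp (σ : G) : Set (L.Formula (A ⊕ (B' ∪ C : Set M))) :=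
    {φ | φ.Realize (Sum.elim (fun a => σ.1 a) fun e => (e : M))}
  have hQ : #(Quotient (Setoid.ker tp)) < κ :=
    hM.small_of_injective_set_formula (hM.small_sum hA hE) (f := fun p => tp p.out)
      fun p q h => Quotient.out_equiv_out.1 h
  have hU := hM.small_union hB' (hM.small_iUnion hQ fun p => hsmall p.out)
  obtain ⟨_, ⟨σ, hσ, rfl⟩, hR⟩ := h _ hU (hBB'.trans subset_union_left)
  let p : Quotient (Setoid.ker tp) := Quotient.mk _ ⟨σ, hσ⟩
  have htp : tp p.out = tp ⟨σ, hσ⟩ := Quotient.mk_out (s := Setoid.ker tp) _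
  obtain ⟨ρ, hρ⟩ := hM.exists_equiv_of_realize_iff (hM.small_sum hA hE) fun φ =>
    Set.ext_iff.1 htp φ
  refine hbad p.out (σ '' A) ⟨ρ, fun c hc => hρ (Sum.inr ⟨c, hc⟩), ?_⟩
    (hmon _ _ _ _ _ (small_image hA σ) hU hC hR subset_rfl
      ((subset_iUnion (fun p => bad (Quotient.out p)) p).trans subset_union_right))
  rw [image_image]
  exact image_congr fun a ha => hρ (Sum.inl ⟨a, ha⟩)

/-- For each finite part of `A` some automorphism over `B ∪ C` makes it M-independent from `B'`. A
limit of these automorphisms, restricted to `A`, is realised in `M` and gives one conjugate that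
works for all of `A`. -/
theorem finiteCharacter_thornIndep (hM : IsBigModel T κ sorts) :
    FiniteCharacter κ (thornIndep L κ : TernaryRel M) := by
  intro A B C hA hB hC h B' hB' hBB'
  let Z (A₀ : Finset A) : Set (M ≃[L] M) :=
    {σ | (∀ c ∈ B ∪ C, σ c = c) ∧ mIndep L (σ '' (Subtype.val '' (A₀ : Set A))) C B'}
  have hZ {A₀ A₁ : Finset A} (h : A₀ ⊆ A₁) : Z A₁ ⊆ Z A₀ := fun σ hσ =>
    ⟨hσ.1, hσ.2.mono (image_mono (image_mono (by exact_mod_cast h))) subset_rfl⟩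
  let 𝓕 : Filter (M ≃[L] M) := ⨅ A₀ : Finset A, 𝓟 (Z A₀)
  have hmem (A₀ : Finset A) : ∀ᶠ σ in 𝓕, σ ∈ Z A₀ :=
    mem_iInf_of_mem A₀ (mem_principal_self _)
  have : 𝓕.NeBot := by
    classical
    refine iInf_neBot_of_directed (fun A₀ A₁ => ⟨A₀ ∪ A₁, ?_, ?_⟩) fun A₀ => ?_
    · exact principal_mono.2 (hZ Finset.subset_union_left)
    · exact principal_mono.2 (hZ Finset.subset_union_right)
    · obtain ⟨_, ⟨σ, hσ, rfl⟩, hR⟩ := h (Subtype.val '' (A₀ : Set A))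
        (Subtype.coe_image_subset _ _) (A₀.finite_toSet.image _) B' hB' hBB'
      exact principal_neBot_iff.2 ⟨σ, hσ, hR⟩
  have hfix : ∀ᶠ σ in 𝓕, ∀ c ∈ B ∪ C, σ c = c := (hmem ∅).mono fun σ hσ => hσ.1
  -- `D` contains every base `C'` and every element `e` that can witness a failure of
  -- M-independence, so the limit type is taken over `D`.
  let D := acl L (B' ∪ C)
  have hBD : B ∪ C ⊆ D := (union_subset_union_left C hBB').trans (subset_acl _)
  obtain ⟨g, hg⟩ := hM.exists_tuple_of_eventually 𝓕
    (hM.small_acl (hM.small_union hB' hC)) hA (fun d : D => (d : M)) (fun σ a => σ a)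
    fun a => by
      obtain ⟨s, hs, -⟩ := hM.sorting.existsUnique a
      exact ⟨s, Eventually.of_forall fun σ => (hM.image_sort σ s).2 hs⟩
  have hext : ∀ φ : L.Formula ((B ∪ C : Set M) ⊕ A),
      φ.Realize (Sum.elim (fun c => (c : M)) fun a => (a : M)) →
        φ.Realize (Sum.elim (fun c => (c : M)) g) := by
    intro φ hφ
    have hr (f : A → M) : (φ.relabel (Sum.map (inclusion hBD) id)).Realize
        (Sum.elim (fun d : D => (d : M)) f) ↔ φ.Realize (Sum.elim (fun c => (c : M)) f) := by
      rw [Formula.realize_relabel]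
      apply iff_of_eq
      congr 1
      ext i
      cases i <;> rfl
    refine (hr g).1 (hg _ (hfix.mono fun σ hσ => (hr _).2 ?_))
    rw [← realize_equiv_comp σ] at hφ
    convert hφ using 1
    ext i
    rcases i with i | i
    · exact (hσ i i.2).symm
    · rfl
  obtain ⟨τ, hτ⟩ := hM.exists_equiv_of_realize_iff
    (hM.small_sum (small_subset (hM.small_union hB' hC) (union_subset_union_left C hBB')) hA)
    fun φ => ⟨hext φ, fun h => by
      by_contra h'
      exact hext φ.not h' h⟩
  refine ⟨τ '' A, ⟨τ, fun c hc => hτ (Sum.inl ⟨c, hc⟩), rfl⟩, mIndep_iff.2 ?_⟩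
  intro C' h₁ h₂ e h₃ h₄
  have heD : e ∈ D := by
    have := acl_mono (union_subset_union_right B' h₂) h₄
    rwa [acl_union_acl, ← union_assoc, union_self] at this
  obtain ⟨E, hE, hEfin, heE⟩ := exists_finite_of_mem_acl h₃
  let A₀ : Set A := (fun a : A => τ a) ⁻¹' E
  have hA₀ : A₀.Finite := hEfin.preimage (τ.injective.comp Subtype.val_injective).injOn
  have heA₀ : e ∈ acl L (range (Sum.elim (fun a : A₀ => τ a) fun c : C' => (c : M))) := by
    refine acl_mono (fun x hx => ?_) heE
    rw [Set.Sum.elim_range, Subtype.range_coe]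
    rcases hE hx with ⟨a, ha, rfl⟩ | hx'
    · exact Or.inl ⟨⟨⟨a, ha⟩, hx⟩, rfl⟩
    · exact Or.inr hx'
  obtain ⟨χ, hχ, hfin⟩ := mem_acl_range_iff.1 heA₀
  let n := {x | χ.Realize (Sum.elim (Sum.elim (fun a : A₀ => τ a) fun c : C' => (c : M))
    fun _ => x)}.ncard
  let r : A₀ ⊕ C' → D ⊕ A := Sum.elim (fun a => Sum.inr a) fun c => Sum.inl ⟨c, h₂ c.2⟩
  -- `θ` expresses that `e` is algebraic over `C'` and the finitely many coordinates in `A₀`, with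
  -- the bound `n` making this first-order.
  let θ : L.Formula (D ⊕ A) :=
    (solutionsLe χ n).relabel r ⊓ χ.relabel (Sum.elim r fun _ => Sum.inl ⟨e, heD⟩)
  have hθ (f : A → M) : θ.Realize (Sum.elim (fun d : D => (d : M)) f) ↔
      {x | χ.Realize (Sum.elim (Sum.elim (fun a : A₀ => f a) fun c : C' => (c : M))
        fun _ => x)}.encard ≤ n ∧
      χ.Realize (Sum.elim (Sum.elim (fun a : A₀ => f a) fun c : C' => (c : M)) fun _ => e) := by
    have hr : Sum.elim (fun d : D => (d : M)) f ∘ r =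
        Sum.elim (fun a : A₀ => f a) fun c : C' => (c : M) := by
      ext i
      cases i <;> rfl
    have hr' : Sum.elim (fun d : D => (d : M)) f ∘ Sum.elim r (fun _ : Unit => Sum.inl ⟨e, heD⟩) =
        Sum.elim (Sum.elim (fun a : A₀ => f a) fun c : C' => (c : M)) fun _ => e := by
      ext i
      rcases i with i | i
      · exact congrFun hr i
      · rfl
    simp only [θ, Formula.realize_inf, Formula.realize_relabel, realize_solutionsLe, hr, hr']
  have hgθ : θ.Realize (Sum.elim (fun d : D => (d : M)) g) := by
    have : g = fun a : A => τ a := funext fun a => (hτ (Sum.inr a)).symm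
    rw [this, hθ]
    exact ⟨hfin.cast_ncard_eq.ge, hχ⟩
  -- If `θ` failed eventually, its negation would pass to the limit `g`.
  have hfreq : ∃ᶠ σ in 𝓕, θ.Realize (Sum.elim (fun d : D => (d : M)) fun a => σ a) :=
    fun hnot => hg θ.not hnot hgθ
  obtain ⟨σ, hσ, hσZ⟩ := (hfreq.and_eventually (hmem hA₀.toFinset)).exists
  obtain ⟨hle, hσχ⟩ := (hθ _).1 hσ
  refine mIndep_iff.1 hσZ.2 C' h₁ h₂ e ?_ h₄
  have := mem_acl_range_iff.2 ⟨χ, hσχ, finite_of_encard_le_coe hle⟩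
  rw [Set.Sum.elim_range, Subtype.range_coe] at this
  refine acl_mono (union_subset_union_left C' ?_) this
  rintro _ ⟨a, rfl⟩
  exact ⟨a, ⟨a, by simp, rfl⟩, rfl⟩

theorem isStrictIndependenceRelation_thornIndep (hM : IsBigModel T κ sorts)
    (h : LocalCharacter κ (thornIndep L κ : TernaryRel M)) :
    IsStrictIndependenceRelation L κ (thornIndep L κ : TernaryRel M) where
  invariance := invariance_star (invariance_mIndep κ)
  monotonicity := hM.monotonicity_star (monotonicity_mIndep κ)
  baseMonotonicity := baseMonotonicity_star (baseMonotonicity_mIndep κ)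
  transitivity := transitivity_star (invariance_mIndep κ) (transitivity_mIndep κ)
  normality := normality_star (normality_mIndep κ)
  extension := hM.extension_star (monotonicity_mIndep κ)
  finiteCharacter := hM.finiteCharacter_thornIndep
  localCharacter := h
  antiReflexivity := fun a _ hB ha =>
    have hs := hM.small_of_finite (finite_singleton a)
    mem_acl_of_mIndep_self (of_star (invariance_mIndep κ) hs hs hB ha)

end IsBigModel

end Star

end Independence

namespace Independence

open FirstOrder.Language Set Order

/-! ### Symmetry of independence relations, and the comparison with thorn-forking. -/

section Symmetry

variable {L : FirstOrder.Language.{u, v}} {M : Type w} [L.Structure M]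
  {T : L.Theory} {κ : Cardinal.{w}} {S : Type t} {sorts : S → Set M} {R : TernaryRel M}

namespace IsIndependenceRelation

/-- Extension moves `A` over `B ∪ C`; undoing the move fixes `C` pointwise and `B'` setwise. -/
theorem right_extend (h : IsIndependenceRelation L κ R) {A B C B' : Set M}
    (hA : #A < κ) (hC : #C < κ) (hB' : #B' < κ) (hR : R A C B) (hBB' : B ⊆ B')
    (hfix : ∀ σ : M ≃[L] M, (∀ c ∈ B ∪ C, σ c = c) → σ '' B' = B') : R A C B' := by
  obtain ⟨_, ⟨σ, hσ, rfl⟩, h'⟩ := h.extension A B C B' hA hC hB' hR hBB'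
  have := h.invariance _ _ _ (IsBigModel.small_image hA σ) hB' hC h' σ.symm
  rwa [image_symm_image, image_eq_of_fixes (symm_fixes hσ) subset_union_right,
    hfix _ (symm_fixes hσ)] at this

open IsBigModel

theorem right_union (hM : IsBigModel T κ sorts) (h : IsIndependenceRelation L κ R)
    {A B C : Set M} (hA : #A < κ) (hB : #B < κ) (hC : #C < κ) (hR : R A C B) :
    R A C (B ∪ C) :=
  h.right_extend hA hC (hM.small_union hB hC) hR subset_union_left
    fun _ hσ => image_eq_of_fixes hσ subset_rfl

theorem right_acl (hM : IsBigModel T κ sorts) (h : IsIndependenceRelation L κ R)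
    {A B C : Set M} (hA : #A < κ) (hB : #B < κ) (hC : #C < κ) (hR : R A C B) :
    R A C (acl L (B ∪ C)) :=
  h.right_extend hA hC (hM.small_acl (hM.small_union hB hC)) hR
    (subset_union_left.trans (subset_acl _))
    fun σ hσ => by rw [image_acl, image_eq_of_fixes hσ subset_rfl]

/-- If `X` and `A` are both independent from `B`, then a conjugate `A'` of `A` can be chosen such
that `X` is independent from `B ∪ A'`. -/
theorem exists_conjugate (hM : IsBigModel T κ sorts) (h : IsIndependenceRelation L κ R)
    {A B C X : Set M} (hA : #A < κ) (hB : #B < κ) (hC : #C < κ) (hX : #X < κ) (hR : R X C B) :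
    ∃ A', EquivOver L (B ∪ C) A A' ∧ R X C (B ∪ A') := by
  have hBA := hM.small_union hB hA
  -- Extension moves `X`; pulling back by `σ` restores `X` and moves `A` instead.
  obtain ⟨_, ⟨σ, hσ, rfl⟩, h'⟩ := h.extension X B C (B ∪ A) hX hC hBA hR subset_union_left
  refine ⟨_, ⟨σ.symm, symm_fixes hσ, rfl⟩, ?_⟩
  have := h.invariance _ _ _ (small_image hX σ) hBA hC h' σ.symm
  rwa [image_symm_image, image_eq_of_fixes (symm_fixes hσ) subset_union_right, image_union,
    image_eq_of_fixes (symm_fixes hσ) subset_union_left] at this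

/-- Base monotonicity moves the independence of `X` to the base `A ∪ C`, and transitivity composes
it with that of `A`. -/
theorem union_left (hM : IsBigModel T κ sorts) (h : IsIndependenceRelation L κ R)
    {A B C X : Set M} (hA : #A < κ) (hB : #B < κ) (hC : #C < κ) (hX : #X < κ)
    (hR : R X C (B ∪ A)) (hR' : R A C B) : R (X ∪ A) C B := by
  have hBA := hM.small_union hB hA
  have hAC := hM.small_union hA hC
  have hs := hM.small_union hBA hC
  have h₁ : R X (A ∪ C) ((B ∪ A) ∪ C) :=
    h.baseMonotonicity _ _ _ C hX hs subset_union_right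
      (union_subset_union_left C subset_union_right) (h.right_union hM hX hBA hC hR)
  have h₂ : R X (A ∪ C) B := h.monotonicity _ _ _ _ _ hX hs hAC h₁ subset_rfl
    (subset_union_left.trans subset_union_left)
  have hXAC := hM.small_union hX hAC
  have h₃ := h.transitivity B (X ∪ (A ∪ C)) (A ∪ C) C hB hXAC
    subset_union_right subset_union_right (h.normality _ _ _ hX hB hAC h₂)
    (h.normality _ _ _ hA hB hC hR')
  exact h.monotonicity _ _ _ _ _ hXAC hB hC h₃
    (union_subset_union_right X subset_union_left) subset_rfl

theorem of_conjugate_left (h : IsIndependenceRelation L κ R) {A A' B C : Set M}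
    (hA : #A < κ) (hB : #B < κ) (hC : #C < κ) (hR : R A C B)
    (hAA' : EquivOver L (B ∪ C) A A') : R A' C B := by
  obtain ⟨σ, hσ, rfl⟩ := hAA'
  have := h.invariance _ _ _ hA hB hC hR σ
  rwa [image_eq_of_fixes hσ subset_union_left, image_eq_of_fixes hσ subset_union_right] at this

theorem of_conjugate_right (h : IsIndependenceRelation L κ R) {A A' B C : Set M}
    (hA : #A < κ) (hB : #B < κ) (hC : #C < κ) (hR : R B C A)
    (hAA' : EquivOver L (B ∪ C) A A') : R B C A' := by
  obtain ⟨σ, hσ, rfl⟩ := hAA'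
  have := h.invariance _ _ _ hB hA hC hR σ
  rwa [image_eq_of_fixes hσ subset_union_left, image_eq_of_fixes hσ subset_union_right] at this

theorem small_of_equivOver {A A' C : Set M} (hA : #A < κ) (h : EquivOver L C A A') :
    #A' < κ := by
  obtain ⟨σ, -, rfl⟩ := h
  exact small_image hA σ

/-- Conjugates of `A` over `B ∪ C` can be arranged in a sequence of any small length, each of
them having all the previous ones independent from it. -/
theorem exists_sequence (hM : IsBigModel T κ sorts) (h : IsIndependenceRelation L κ R)
    {A B C : Set M} (hA : #A < κ) (hB : #B < κ) (hC : #C < κ) (hR : R A C B)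
    (ι : Type w) [LinearOrder ι] [WellFoundedLT ι] (hι : #ι < κ) :
    ∃ f : ι → Set M, ∀ i, EquivOver L (B ∪ C) A (f i) ∧ R (⋃ j : Iio i, f j) C (f i) := by
  classical
  let f : ι → Set M := wellFounded_lt.fix fun i g =>
    if h : ∃ A', EquivOver L (B ∪ C) A A' ∧ R (⋃ j : Iio i, g j j.2) C (B ∪ A') then h.choose else ∅
  have hf (i : ι) (h : ∃ A', EquivOver L (B ∪ C) A A' ∧ R (⋃ j : Iio i, f j) C (B ∪ A')) :
      EquivOver L (B ∪ C) A (f i) ∧ R (⋃ j : Iio i, f j) C (B ∪ f i) := by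
    have e : f i = h.choose := by
      rw [show f i = _ from wellFounded_lt.fix_eq _ i]
      exact dif_pos h
    rw [e]
    exact h.choose_spec
  have key (i : ι) : #(⋃ j : Iio i, f j) < κ ∧
      EquivOver L (B ∪ C) A (f i) ∧ R (⋃ j : Iio i, f j) C (B ∪ f i) := by
    induction i using WellFoundedLT.induction with
    | ind i ih =>
      have hX : #(⋃ j : Iio i, f j) < κ := hM.small_iUnion ((mk_subtype_le _).trans_lt hι)
        fun j => small_of_equivOver hA (ih j j.2).2.1
      refine ⟨hX, hf i (h.exists_conjugate hM hA hB hC hX ?_)⟩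
      -- A finite subset of the union lies in the stages up to the largest index it uses, where
      -- `union_left` applies to the induction hypothesis.
      refine h.finiteCharacter _ _ _ hX hB hC fun F hF hfin => ?_
      rcases F.eq_empty_or_nonempty with rfl | hne
      · exact h.monotonicity _ _ _ _ _ hA hB hC hR (empty_subset A) subset_rfl
      · have : Nonempty (Iio i) := (mem_iUnion.1 (hF hne.some_mem)).nonempty
        choose! k hk using fun x hx => mem_iUnion.1 (hF (a := x) hx)
        obtain ⟨x, -, hx⟩ := exists_max_image F k hfin hne
        obtain ⟨hsX, hequiv, hind⟩ := ih (k x) (k x).2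
        have hs := small_of_equivOver hA hequiv
        refine h.monotonicity _ _ _ _ _ (hM.small_union hsX hs) hB hC
          (h.union_left hM hs hB hC hsX hind (h.of_conjugate_left hA hB hC hR hequiv))
          (fun y hy => ?_) subset_rfl
        rcases (hx y hy).lt_or_eq with hlt | heq
        · exact Or.inl (mem_iUnion.2 ⟨⟨k y, hlt⟩, hk y hy⟩)
        · exact Or.inr (heq ▸ hk y hy)
  refine ⟨f, fun i => ⟨(key i).2.1, ?_⟩⟩
  have hs := small_of_equivOver hA (key i).2.1
  exact h.monotonicity _ _ _ _ _ (key i).1 (hM.small_union hB hs) hC (key i).2.2 subset_rfl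
    subset_union_right

/-- Let `X` be the union of the stages before `i`. For large `i`, local character gives that `B` is
independent from `f i` over `C ∪ X`. As `X` is independent from `f i` over `C`, transitivity makes
`B` independent from `f i` over `C`, and `f i` is conjugate to `A` over `B ∪ C`. -/
theorem symm (hM : IsBigModel T κ sorts) (h : IsIndependenceRelation L κ R) {A B C : Set M}
    (hA : #A < κ) (hB : #B < κ) (hC : #C < κ) (hR : R A C B) : R B C A := by
  obtain ⟨μ, hμ, hloc⟩ := h.localCharacter B hB
  -- An infinite successor is regular, so a set of size `< μ` is bounded in a sequence of length
  -- `ν`.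
  let ν : Cardinal.{w} := succ (max ℵ₀ μ)
  have hν : ν < κ := hM.inaccessible.isSuccLimit.succ_lt
    (max_lt hM.inaccessible.aleph0_lt hμ)
  have hreg : ν.IsRegular := isRegular_succ (le_max_left _ _)
  let ι := ν.ord.ToType
  have hι : #ι < κ := by simpa [ι] using hν
  have hcof : Order.cof ι = ν := by rw [Ordinal.cof_toType, hreg.cof_ord]
  obtain ⟨f, hf⟩ := h.exists_sequence hM hA hB hC hR ι hι
  have hs (i : ι) : #(f i) < κ := small_of_equivOver hA (hf i).1
  have hD : #(C ∪ ⋃ i, f i : Set M) < κ := hM.small_union hC (hM.small_iUnion hι hs)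
  obtain ⟨C₀, hC₀, hcard, hind⟩ := hloc _ hD
  have : Nonempty ι := Ordinal.nonempty_toType_iff.2 (ord_eq_zero.not.2 hreg.pos.ne')
  obtain ⟨i, hi⟩ : ∃ i : ι, C₀ ⊆ C ∪ ⋃ j : Iio i, f j := by
    have hk : ∀ c : C₀, ∃ k, (c : M) ∈ C ∪ f k := fun c => by
      rcases hC₀ c.2 with hc | hc
      · exact ⟨Classical.arbitrary ι, Or.inl hc⟩
      · obtain ⟨k, hk⟩ := mem_iUnion.1 hc
        exact ⟨k, Or.inr hk⟩
    choose k hk using hk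
    have hnot : ¬ IsCofinal (range k) := fun hcofinal => by
      have h₁ := (Order.cof_le hcofinal).trans mk_range_le
      rw [hcof] at h₁
      exact (h₁.trans_lt hcard).not_ge ((le_max_right _ _).trans (le_succ _))
    simp only [IsCofinal, not_forall, not_exists, not_and, not_le] at hnot
    obtain ⟨i, hi⟩ := hnot
    refine ⟨i, fun c hc => ?_⟩
    rcases hk ⟨c, hc⟩ with h' | h'
    · exact Or.inl h'
    · exact Or.inr (mem_iUnion.2 ⟨⟨k ⟨c, hc⟩, hi _ (mem_range_self _)⟩, h'⟩)
  let X := ⋃ j : Iio i, f j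
  have hXs : #X < κ := hM.small_iUnion ((mk_subtype_le _).trans_lt hι) fun j => hs j
  have hXC := hM.small_union hC hXs
  have hBXC := hM.small_union hB hXC
  have hXD : X ⊆ ⋃ i, f i := iUnion_subset fun j => subset_iUnion f j
  have h₁ : R B (C ∪ X) (f i) := h.monotonicity _ _ _ _ _ hB hD hXC
    (h.baseMonotonicity _ _ _ _ hB hD hi (union_subset_union_right C hXD) hind) subset_rfl
    ((subset_iUnion f i).trans subset_union_right)
  have h₂ : R (C ∪ X) C (f i) := by
    rw [union_comm]
    exact h.normality _ _ _ hXs (hs i) hC (hf i).2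
  have h₃ := h.transitivity (f i) (B ∪ (C ∪ X)) (C ∪ X) C (hs i) hBXC subset_union_left
    subset_union_right (h.normality _ _ _ hB (hs i) hXC h₁) h₂
  exact h.of_conjugate_right (hs i) hB hC
    (h.monotonicity _ _ _ _ _ hBXC (hs i) hC h₃ subset_union_left subset_rfl) (hf i).1.symm

end IsIndependenceRelation

namespace IsStrictIndependenceRelation

theorem mIndep (hM : IsBigModel T κ sorts) (h : IsStrictIndependenceRelation L κ R)
    {A B C : Set M} (hA : #A < κ) (hB : #B < κ) (hC : #C < κ) (hR : R A C B) :
    mIndep L A C B := by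
  have hi := h.toIsIndependenceRelation
  rw [mIndep_iff]
  intro C' h₁ h₂ e h₃ h₄
  have hBC := hM.small_acl (hM.small_union hB hC)
  have hC' := IsBigModel.small_subset hBC h₂
  have he := hM.small_of_finite (finite_singleton e)
  have heB : {e} ⊆ acl L (B ∪ C) := singleton_subset_iff.2 (acl_subset_acl
    (union_subset (subset_union_left.trans (subset_acl _)) h₂) h₄)
  -- As `e ∈ acl (B ∪ C)`, `A` is independent from `e` over `C'`. After symmetry, closing the right
  -- side to `acl (A ∪ C')` captures `e` again.
  have h₅ : R A C' {e} := hi.monotonicity _ _ _ _ _ hA hBC hC'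
    (hi.baseMonotonicity _ _ _ _ hA hBC h₁ h₂ (hi.right_acl hM hA hB hC hR)) subset_rfl heB
  have h₆ := hi.right_acl hM he hA hC' (hi.symm hM hA he hC' h₅)
  exact h.antiReflexivity e C' hC' (hi.monotonicity _ _ _ _ _ he
    (hM.small_acl (hM.small_union hA hC')) hC' h₆ subset_rfl (singleton_subset_iff.2 h₃))

theorem isFinerThan_thornIndep (hM : IsBigModel T κ sorts)
    (h : IsStrictIndependenceRelation L κ R) : IsFinerThan κ R (thornIndep L κ) := by
  intro A B C hA hB hC hR B' hB' hBB'
  obtain ⟨A', hAA', hR'⟩ := h.extension A B C B' hA hC hB' hR hBB'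
  exact ⟨A', hAA', h.mIndep hM (IsIndependenceRelation.small_of_equivOver hA hAA') hB' hC hR'⟩

theorem localCharacter_thornIndep (hM : IsBigModel T κ sorts)
    (h : IsStrictIndependenceRelation L κ R) :
    LocalCharacter κ (thornIndep L κ : TernaryRel M) := by
  intro A hA
  obtain ⟨μ, hμ, hloc⟩ := h.localCharacter A hA
  refine ⟨μ, hμ, fun B hB => ?_⟩
  obtain ⟨C, hCB, hC, hR⟩ := hloc B hB
  exact ⟨C, hCB, hC, h.isFinerThan_thornIndep hM A B C hA hB (hC.trans hμ) hR⟩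

end IsStrictIndependenceRelation

end Symmetry

end Independence

theorem mainTheorem3
    {L : FirstOrder.Language.{u, v}} (T : L.Theory) (hT : T.IsComplete)
    {M : Type w} [L.Structure M] [Nonempty M] {S : Type t} (sorts : S → Set M)
    (κ : Cardinal.{w}) (hM : Independence.IsBigModel T κ sorts) :
    (Independence.IsStrictIndependenceRelation L κ
        (Independence.thornIndep L κ : Independence.TernaryRel M) ↔
      Independence.LocalCharacter κ
        (Independence.thornIndep L κ : Independence.TernaryRel M)) ∧
    (Independence.LocalCharacter κ
        (Independence.thornIndep L κ : Independence.TernaryRel M) ↔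
      ∃ R : Independence.TernaryRel M, Independence.IsStrictIndependenceRelation L κ R) ∧
    (Independence.IsStrictIndependenceRelation L κ
        (Independence.thornIndep L κ : Independence.TernaryRel M) →
      ∀ R : Independence.TernaryRel M, Independence.IsStrictIndependenceRelation L κ R →
        Independence.IsFinerThan κ R (Independence.thornIndep L κ)) := by
  exact ⟨⟨fun h => h.localCharacter, hM.isStrictIndependenceRelation_thornIndep⟩,
    ⟨fun h => ⟨_, hM.isStrictIndependenceRelation_thornIndep h⟩,
      fun ⟨_, hR⟩ => hR.localCharacter_thornIndep hM⟩,
    fun _ _ hR => hR.isFinerThan_thornIndep hM⟩
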